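/- Let $K$ be a field of characteristic $0$ that is complete with respect to a nontrivial non-archimedean absolute value. A power series is called locally analytic if its radius of convergence $\left(\limsup_n |a_n|^{1/n}\right)^{-1}$ is positive, and tangent to the identity if it has the form $x+O(x^2)$. Below, $h\circ f\circ h^{-1}$ is formed with series $h$ such that $h(0)=0$ and $h'(0)\neq 0$, and $h^{-1}$ is the compositional inverse. Two series over a field are formally equivalent over it if $h\circ f\circ h^{-1}=g$ for some such $h$, and analytically equivalent if $h$ can be taken locally analytic. (1) Let $f(x)=x+a_mx^m+O(x^{m+1})\in K[[x]]$ be locally analytic, with $m\ge 2$ and $a_m\ne 0$. Let $\alpha$ be a root of $\alpha^{m-1}=a_m$ in an extension field of $K$, and let $\widetilde K=K[\alpha]$ carry the absolute value extending that of $K$. Then there are $\mu\in\widetilde K$ and a locally analytic $h\in\widetilde K[[x]]$ tangent to the identity such that, with $L_\alpha(x)=\alpha x$, $$(h\circ L_\alpha)\circ f\circ (h\circ L_\alpha)^{-1}(x)=x+x^m+\mu x^{2m-1}.$$ In particular, if $a_m=1$ one may take $\alpha=1$ and $\widetilde K=K$, and then $h\circ f\circ h^{-1}(x)=x+x^m+\mu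 x^{2m-1}$. (2) The numbers $m$ and $\mu$ are analytic invariants: let $f=x+a_mx^m+O(x^{m+1})$ and $g=x+b_{m'}x^{m'}+O(x^{m'+1})$ be locally analytic over $K$, with $m,m'\ge2$ and $a_m,b_{m'}\neq0$, and let $L$ be a field extension of $K$ with an absolute value extending that of $K$. If $f$ and $g$ are analytically equivalent over $L$, then $m=m'$; and if moreover $f$ is analytically equivalent over $L$ to $x+x^m+\mu x^{2m-1}$ and $g$ to $x+x^{m'}+\mu' x^{2m'-1}$, where $\mu,\mu'\in L$, then $\mu=\mu'$. (With $f=g$: $\mu$ is determined by $f$.) (3) The formal and the analytic classification coincide: let $f,g\in K[[x]]$ be locally analytic and tangent to the identity, and let $c\in K$. There is a formal series $h\in K[[x]]$ with $h'(0)=c$ and $h\circ f\circ h^{-1}=g$ if and only if there is a locally analytic one. -/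

import Mathlib

open Filter
open scoped PowerSeries ENNReal IntermediateField

universe u v

namespace TangentToIdentity

/-- The radius of convergence about `0` of `∑ aₙ xⁿ`, namely `(limsup |aₙ|^(1/n))⁻¹`, computed in
`[0, ∞]`. -/
noncomputable def convergenceRadius {F : Type*} [NormedField F] (f : F⟦X⟧) : ℝ≥0∞ :=
  (limsup (fun n : ℕ => ‖PowerSeries.coeff n f‖ₑ ^ (1 / (n : ℝ))) atTop)⁻¹

/-- A power series is locally analytic at `0` if its radius of convergence is positive. -/
def LocallyAnalytic {F : Type*} [NormedField F] (f : F⟦X⟧) : Prop :=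
  0 < convergenceRadius f

/-- The composition `f ∘ g` of formal power series; it is only used for `g` without constant
term. -/
noncomputable def comp {F : Type*} [Field F] (f g : F⟦X⟧) : F⟦X⟧ :=
  PowerSeries.subst g f

/-- The series `x + O(x ^ 2)`. -/
def IsTangentToId {F : Type*} [Field F] (f : F⟦X⟧) : Prop :=
  PowerSeries.coeff 0 f = 0 ∧ PowerSeries.coeff 1 f = 1

/-- `f = x + a x ^ m + O(x ^ (m + 1))` with `2 ≤ m` and `a ≠ 0`. -/
def HasLeadingTerm {F : Type*} [Field F] (f : F⟦X⟧) (m : ℕ) (a : F) : Prop :=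
  IsTangentToId f ∧ 2 ≤ m ∧ (∀ n, 1 < n → n < m → PowerSeries.coeff n f = 0) ∧
    PowerSeries.coeff m f = a ∧ a ≠ 0

/-- The series `h` fixes the origin, is invertible under composition, and `h ∘ f ∘ h⁻¹ = g`; here
`k` is the compositional inverse `h⁻¹`. -/
def Conjugates {F : Type*} [Field F] (h f g : F⟦X⟧) : Prop :=
  PowerSeries.coeff 0 h = 0 ∧
    ∃ k : F⟦X⟧, PowerSeries.coeff 0 k = 0 ∧ comp h k = PowerSeries.X ∧
      comp k h = PowerSeries.X ∧ comp h (comp f k) = g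

/-- `f` and `g` are conjugate by a locally analytic germ fixing the origin. -/
def AnalyticallyEquivalent {F : Type*} [NormedField F] (f g : F⟦X⟧) : Prop :=
  ∃ h : F⟦X⟧, LocallyAnalytic h ∧ Conjugates h f g

/-- The linear map `x ↦ α x`. -/
noncomputable def dilation {F : Type*} [Field F] (α : F) : F⟦X⟧ :=
  PowerSeries.C α * PowerSeries.X

/-- The normal form `x + x ^ m + μ x ^ (2 m - 1)`, for `2 ≤ m`. -/
noncomputable def normalForm {F : Type*} [Field F] (m : ℕ) (μ : F) : F⟦X⟧ :=
  PowerSeries.X + PowerSeries.X ^ m + PowerSeries.C μ * PowerSeries.X ^ (2 * m - 1)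

end TangentToIdentity

/-! Write m = d + 1 and let f, g share the leading coefficient a. A conjugacy is a series h whose
defect h ∘ f - g ∘ h vanishes. Changing h by b x^n + ⋯ with n ≥ 2 changes the defect by (n - (d +
1)) a b x^(n + d) + ⋯ (`X_pow_dvd_defect_sub_defect`). In characteristic 0 the equations for the
coefficients of h are therefore triangular and solvable, except at the resonance n = d + 1, which is
order 2d + 1 = 2m - 1 of the defect; the obstruction there is μ. This yields both the formal normal
form (`exists_comp_eq_normalForm_comp`) and the uniqueness of μ (`normalForm_injective`).

Convergence is then automatic. Solving for the n-th coefficient divides by (n - d - 1) a, and sums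
cost nothing in an ultrametric field. Once a dilation has made f, g and the first coefficients of h
integral, only these divisors accumulate, so |h_n| is at most the inverse of |a^(n-d-1) (n-d-1)!|
(`norm_coeff_mul_le_one_of_comp_eq`). Since |k!| ≥ c^k for some c > 0
(`exists_pow_le_norm_factorial`), this growth is geometric, and every conjugacy tangent to the
identity is locally analytic (`locallyAnalytic_of_comp_eq`).

Other multipliers reduce to this case by dilations. The exception is f = g = x, where a formal
conjugacy may diverge and a dilation replaces it. -/

namespace TangentToIdentity

open PowerSeries

/-! ### Composition of formal series and the first variation of the defect. -/

section Composition

variable {F : Type*} [Field F]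

lemma hasSubst_of_coeff_zero {g : F⟦X⟧} (hg : coeff 0 g = 0) : HasSubst g :=
  HasSubst.of_constantCoeff_zero' (by simpa using hg)

lemma X_dvd_of_coeff_zero {g : F⟦X⟧} (hg : coeff 0 g = 0) : X ∣ g :=
  X_dvd_iff.2 (by simpa using hg)

lemma coeff_pow_eq_zero {g : F⟦X⟧} (hg : coeff 0 g = 0) {n k : ℕ} (h : n < k) :
    coeff n (g ^ k) = 0 :=
  X_pow_dvd_iff.1 (pow_dvd_pow_of_dvd (X_dvd_of_coeff_zero hg) k) n h

lemma coeff_comp {g : F⟦X⟧} (hg : coeff 0 g = 0) (f : F⟦X⟧) (n : ℕ) :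
    coeff n (comp f g) = ∑ k ∈ Finset.range (n + 1), coeff k f * coeff n (g ^ k) := by
  rw [comp, coeff_subst' (hasSubst_of_coeff_zero hg)]
  simp only [smul_eq_mul]
  apply finsum_eq_sum_of_support_subset
  intro k hk
  by_contra hk'
  simp only [Finset.coe_range, Set.mem_Iio, not_lt] at hk'
  exact hk (by simp only [coeff_pow_eq_zero hg (show n < k by omega), mul_zero])

lemma coeff_zero_comp {f g : F⟦X⟧} (hg : coeff 0 g = 0) : coeff 0 (comp f g) = coeff 0 f := by
  simp [coeff_comp hg]

lemma coeff_one_comp {f g : F⟦X⟧} (hg : coeff 0 g = 0) :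
    coeff 1 (comp f g) = coeff 1 f * coeff 1 g := by
  simp [coeff_comp hg, Finset.sum_range_succ, coeff_one]

lemma comp_assoc {f g h : F⟦X⟧} (hg : coeff 0 g = 0) (hh : coeff 0 h = 0) :
    comp (comp f g) h = comp f (comp g h) :=
  subst_comp_subst_apply (hasSubst_of_coeff_zero hg) (hasSubst_of_coeff_zero hh) f

lemma comp_X (f : F⟦X⟧) : comp f X = f := X_subst f

lemma X_comp {g : F⟦X⟧} (hg : coeff 0 g = 0) : comp X g = g :=
  subst_X (hasSubst_of_coeff_zero hg)

lemma C_comp (c : F) (g : F⟦X⟧) : comp (C c) g = C c := subst_C c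

lemma comp_add {g : F⟦X⟧} (hg : coeff 0 g = 0) (a b : F⟦X⟧) :
    comp (a + b) g = comp a g + comp b g := subst_add (hasSubst_of_coeff_zero hg) a b

lemma comp_sub {g : F⟦X⟧} (hg : coeff 0 g = 0) (a b : F⟦X⟧) :
    comp (a - b) g = comp a g - comp b g := subst_sub (hasSubst_of_coeff_zero hg) a b

lemma comp_mul {g : F⟦X⟧} (hg : coeff 0 g = 0) (a b : F⟦X⟧) :
    comp (a * b) g = comp a g * comp b g := subst_mul (hasSubst_of_coeff_zero hg) a b

lemma comp_pow {g : F⟦X⟧} (hg : coeff 0 g = 0) (a : F⟦X⟧) (n : ℕ) :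
    comp (a ^ n) g = comp a g ^ n := subst_pow (hasSubst_of_coeff_zero hg) a n

lemma X_pow_dvd_comp_sub_comp {g h : F⟦X⟧} (hg : coeff 0 g = 0) (hh : coeff 0 h = 0) {n : ℕ}
    (H : X ^ n ∣ g - h) (f : F⟦X⟧) : X ^ n ∣ comp f g - comp f h := by
  rw [X_pow_dvd_iff]
  intro j hj
  rw [map_sub, coeff_comp hg, coeff_comp hh, ← Finset.sum_sub_distrib]
  refine Finset.sum_eq_zero fun k _ => ?_
  rw [← mul_sub, ← map_sub, X_pow_dvd_iff.1 (H.trans (sub_dvd_pow_sub_pow g h k)) j hj, mul_zero]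

lemma eq_C_add_X_mul (f : F⟦X⟧) : ∃ r, f = C (coeff 0 f) + X * r := by
  obtain ⟨r, hr⟩ : X ∣ f - C (coeff 0 f) := X_dvd_iff.2 (by simp)
  exact ⟨r, by rw [← hr]; ring⟩

lemma exists_eq_X_pow_mul {f : F⟦X⟧} {n : ℕ} (h : X ^ n ∣ f) :
    ∃ r, f = X ^ n * (C (coeff n f) + X * r) := by
  obtain ⟨w, hw⟩ := h
  obtain ⟨r, hr⟩ := eq_C_add_X_mul w
  have : coeff n f = coeff 0 w := by
    rw [hw]; simpa using coeff_X_pow_mul w n 0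
  exact ⟨r, by rw [this, ← hr, hw]⟩

lemma coeff_eq_of_X_pow_succ_dvd {f : F⟦X⟧} {n : ℕ} {c : F}
    (h : X ^ (n + 1) ∣ f - C c * X ^ n) : coeff n f = c := by
  have := X_pow_dvd_iff.1 h n (by omega)
  rw [map_sub, coeff_C_mul, coeff_X_pow_self, mul_one, sub_eq_zero] at this
  exact this

lemma X_pow_dvd_of_X_pow_succ_dvd {f : F⟦X⟧} {n : ℕ} {c : F}
    (h : X ^ (n + 1) ∣ f - C c * X ^ n) : X ^ n ∣ f := by
  have h1 : X ^ n ∣ f - C c * X ^ n := (pow_dvd_pow X (by omega)).trans h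
  simpa using dvd_add h1 (Dvd.intro_left (C c) rfl : X ^ n ∣ C c * X ^ n)

/-- The variation of `δ` under precomposition with `f = x + a x ^ (d + 1) + ⋯`. -/
lemma X_pow_dvd_comp_sub_self {f δ : F⟦X⟧} {d n : ℕ} (hd : 1 ≤ d) (hf : X ^ (d + 1) ∣ f - X)
    (hδ : X ^ n ∣ δ) :
    X ^ (n + d + 1) ∣ comp δ f - δ - C (n * coeff (d + 1) f * coeff n δ) * X ^ (n + d) := by
  obtain ⟨δ₂, hδ₂⟩ := exists_eq_X_pow_mul hδ
  obtain ⟨φ, hφ⟩ := exists_eq_X_pow_mul hf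
  have hcf : coeff (d + 1) (f - X) = coeff (d + 1) f := by
    rw [map_sub, coeff_X, if_neg (by omega), sub_zero]
  rw [hcf] at hφ
  set a := coeff (d + 1) f
  set b := coeff n δ
  have hf0 : coeff 0 f = 0 := by
    have := X_pow_dvd_iff.1 hf 0 (by omega)
    simpa using this
  obtain ⟨w, hw⟩ := X_pow_dvd_comp_sub_comp hf0 (by simp : coeff 0 (X : F⟦X⟧) = 0) hf δ₂
  rw [comp_X] at hw
  -- With f = X (1 + Y) and Y of order at least d, f^n = X^n (1 + nY + rY²). As d ≥ 1, Y² is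
  -- divisible by X^(d+1), so only n a b X^(n+d) survives modulo X^(n+d+1).
  obtain ⟨e, rfl⟩ : ∃ e, d = e + 1 := ⟨d - 1, by omega⟩
  set Y := X ^ (e + 1) * (C a + X * φ) with hY
  have hfY : f = X * (1 + Y) := by
    rw [hY]; linear_combination hφ
  obtain ⟨r, hr⟩ := Polynomial.powAddExpansion 1 Y n
  obtain ⟨s, hs⟩ := Polynomial.powAddExpansion 1 Y (n + 1)
  simp only [one_pow, mul_one] at hr hs
  have hcomp : comp δ f = f ^ n * C b + f ^ (n + 1) * comp δ₂ f := by
    conv_lhs => rw [hδ₂]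
    rw [comp_mul hf0, comp_pow hf0, comp_add hf0, comp_mul hf0, C_comp, X_comp hf0]
    ring
  have hw' : comp δ₂ f = δ₂ + X ^ (e + 1 + 1) * w := by rw [← hw]; ring
  rw [hcomp, hfY, mul_pow, mul_pow, hr, hs, ← hfY, hw']
  rw [show δ = X ^ n * (C b + X * δ₂) from hδ₂]
  refine ⟨(n : F⟦X⟧) * φ * C b + X ^ e * (C a + X * φ) ^ 2 * r * C b + X * w
    + (((n + 1 : ℕ) : F⟦X⟧) * (C a + X * φ) + (C a + X * φ) ^ 2 * X ^ (e + 1) * s)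
      * (δ₂ + X ^ (e + 1 + 1) * w), ?_⟩
  simp only [map_mul, map_natCast]
  rw [hY]
  ring

/-- The variation of `g ∘ h` in `h`, for `g = x + a x ^ (d + 1) + ⋯`. -/
lemma X_pow_dvd_comp_sub_comp_sub {g h h' : F⟦X⟧} {d n : ℕ} (hd : 1 ≤ d) (hg : X ^ (d + 1) ∣ g - X)
    (h0 : coeff 0 h = 0) (h1 : coeff 1 h = 1) (hn : 2 ≤ n) (hh : X ^ n ∣ h - h') :
    X ^ (n + d + 1) ∣ comp g h - comp g h' - (h - h')
      - C ((d + 1) * coeff (d + 1) g * coeff n (h - h')) * X ^ (n + d) := by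
  have h0' : coeff 0 h' = 0 := by
    have := X_pow_dvd_iff.1 hh 0 (by omega)
    rw [map_sub, h0] at this; simpa using this
  have h1' : coeff 1 h' = 1 := by
    have := X_pow_dvd_iff.1 hh 1 (by omega)
    rw [map_sub, h1] at this; exact (sub_eq_zero.1 this).symm
  obtain ⟨w, hw⟩ := exists_eq_X_pow_mul hh
  set b := coeff n (h - h')
  have hcg : coeff (d + 1) (g - X) = coeff (d + 1) g := by
    rw [map_sub, coeff_X, if_neg (by omega), sub_zero]
  obtain ⟨γ₂, hγ₂⟩ := exists_eq_X_pow_mul hg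
  rw [hcg] at hγ₂
  set a := coeff (d + 1) g
  obtain ⟨γ, hγ⟩ : ∃ γ, γ = C a + X * γ₂ := ⟨_, rfl⟩
  rw [← hγ] at hγ₂
  obtain ⟨z, hz⟩ := X_pow_dvd_comp_sub_comp h0 h0' hh γ
  obtain ⟨k, rfl⟩ : ∃ k, n = k + 2 := ⟨n - 2, by omega⟩
  obtain ⟨G, hG⟩ := eq_C_add_X_mul (comp γ h)
  have hG0 : coeff 0 (comp γ h) = a := by
    rw [coeff_zero_comp h0, hγ]; simp
  rw [hG0] at hG
  have hcomp : ∀ l : F⟦X⟧, coeff 0 l = 0 → comp g l = l + l ^ (d + 1) * comp γ l := by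
    intro l hl
    rw [show g = X + X ^ (d + 1) * γ by rw [← hγ₂]; ring, comp_add hl, comp_mul hl, comp_pow hl,
      X_comp hl]
  obtain ⟨u, hu⟩ : ∃ u, h' = X * (1 + X * u) := by
    obtain ⟨q, hq⟩ := X_dvd_of_coeff_zero h0'
    obtain ⟨u, hu⟩ := eq_C_add_X_mul q
    have : coeff 0 q = 1 := by rw [← h1', hq]; simp
    exact ⟨u, by rw [hq, hu, this, map_one]⟩
  set W := C b + X * w with hW
  have hh2 : h = X * ((1 + X * u) + X ^ (k + 1) * W) := by
    linear_combination hw + hu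
  -- Taylor expansion of h^(d+1) about h': the linear term (d + 1) h'^d (h - h') gives the
  -- coefficient claimed, and the quadratic term is negligible because n ≥ 2. The change of γ ∘ h,
  -- being O(X^n), is multiplied by h'^(d+1) and is negligible too.
  obtain ⟨r, hr⟩ := Polynomial.powAddExpansion (1 + X * u) (X ^ (k + 1) * W) (d + 1)
  obtain ⟨s, hs⟩ := Polynomial.powAddExpansion 1 (X * u) d
  simp only [one_pow, mul_one] at hs
  rw [Nat.add_sub_cancel, hs] at hr
  have hpow : h ^ (d + 1) = h' ^ (d + 1) + X ^ (d + 1) *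
      (((d + 1 : ℕ) : F⟦X⟧) * (1 + (d : F⟦X⟧) * (X * u) + s * (X * u) ^ 2) * (X ^ (k + 1) * W)
        + r * (X ^ (k + 1) * W) ^ 2) := by
    rw [hh2, hu, mul_pow, mul_pow, hr]; ring
  have hz' : comp γ h' = C a + X * G - X ^ (k + 2) * z := by
    rw [← hz, ← hG]; ring
  rw [hcomp h h0, hcomp h' h0', hz', hG, hpow, hu, mul_pow]
  refine ⟨((d + 1 : ℕ) : F⟦X⟧) * (w * C a + C b * G + X * w * G
    + ((d : F⟦X⟧) * u + s * X * u ^ 2) * W * (C a + X * G)) + X ^ k * r * W ^ 2 * (C a + X * G)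
    + (1 + X * u) ^ (d + 1) * z, ?_⟩
  simp only [map_mul, map_add, map_natCast, map_one, hW]
  push_cast
  ring

/-- The defect `h ∘ f - g ∘ h` of `h` as a conjugacy from `f` to `g`. -/
noncomputable def defect (f g h : F⟦X⟧) : F⟦X⟧ := comp h f - comp g h

/-- Changing `h` at order `n` changes its defect at order `n + d`, by a factor `(n - (d + 1)) a`. -/
lemma X_pow_dvd_defect_sub_defect {f g h h' : F⟦X⟧} {d n : ℕ} {a : F} (hd : 1 ≤ d)
    (hf : X ^ (d + 1) ∣ f - X) (hfa : coeff (d + 1) f = a)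
    (hg : X ^ (d + 1) ∣ g - X) (hga : coeff (d + 1) g = a)
    (h0 : coeff 0 h = 0) (h1 : coeff 1 h = 1) (hn : 2 ≤ n) (hh : X ^ n ∣ h - h') :
    X ^ (n + d + 1) ∣ defect f g h - defect f g h'
      - C (((n : F) - (d + 1)) * a * coeff n (h - h')) * X ^ (n + d) := by
  have hf0 : coeff 0 f = 0 := by
    have := X_pow_dvd_iff.1 hf 0 (by omega)
    simpa using this
  have A := X_pow_dvd_comp_sub_self hd hf hh
  have B := X_pow_dvd_comp_sub_comp_sub hd hg h0 h1 hn hh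
  rw [hfa] at A
  rw [hga] at B
  convert dvd_sub A B using 1
  rw [comp_sub hf0, defect, defect, show ((n : F) - (d + 1)) * a * coeff n (h - h') =
    n * a * coeff n (h - h') - (d + 1) * a * coeff n (h - h') by ring, map_sub]
  ring

lemma coeff_defect_sub_defect {f g h h' : F⟦X⟧} {d n : ℕ} {a : F} (hd : 1 ≤ d)
    (hf : X ^ (d + 1) ∣ f - X) (hfa : coeff (d + 1) f = a)
    (hg : X ^ (d + 1) ∣ g - X) (hga : coeff (d + 1) g = a)
    (h0 : coeff 0 h = 0) (h1 : coeff 1 h = 1) (hn : 2 ≤ n) (hh : X ^ n ∣ h - h') :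
    coeff (n + d) (defect f g h) - coeff (n + d) (defect f g h') =
      ((n : F) - (d + 1)) * a * (coeff n h - coeff n h') := by
  rw [← map_sub, ← map_sub]
  exact coeff_eq_of_X_pow_succ_dvd
    (X_pow_dvd_defect_sub_defect hd hf hfa hg hga h0 h1 hn hh)

end Composition

/-! ### Triangular systems for the coefficients of a series. -/

section Recursion

variable {F : Type*} [Field F]

/-- The coefficients of the solution of a triangular system of equations for a power series. -/
noncomputable def triangularCoeff (Φ : F⟦X⟧ → F⟦X⟧) (u : ℕ → F) (N d : ℕ) (h₀ : F⟦X⟧) : ℕ → F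
  | n => if n < N then coeff n h₀ else
    -(u n)⁻¹ * coeff (n + d)
      (Φ (mk fun i => if _h : i < n then triangularCoeff Φ u N d h₀ i else 0))

/-- Equation n + d is affine in the n-th unknown, with slope u n, and does not see the later ones.
Where u n = 0 the convention 0⁻¹ = 0 sets the unknown to 0, and that equation is left unsolved: this
is how the resonance is skipped. -/
lemma exists_solution_of_triangular (Φ : F⟦X⟧ → F⟦X⟧) (u : ℕ → F) (N d : ℕ) (h₀ : F⟦X⟧)
    (hΦ : ∀ n, N ≤ n → ∀ h h' : F⟦X⟧, (∀ i < N, coeff i h = coeff i h₀) →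
      (∀ i < N, coeff i h' = coeff i h₀) → X ^ n ∣ h - h' →
      coeff (n + d) (Φ h) - coeff (n + d) (Φ h') = u n * (coeff n h - coeff n h')) :
    ∃ h : F⟦X⟧, (∀ i < N, coeff i h = coeff i h₀) ∧
      ∀ n, N ≤ n → u n ≠ 0 → coeff (n + d) (Φ h) = 0 := by
  set b := triangularCoeff Φ u N d h₀ with hb
  have hlow : ∀ i < N, b i = coeff i h₀ := by
    intro i hi
    rw [hb, triangularCoeff, if_pos hi]
  refine ⟨mk b, fun i hi => by rw [coeff_mk, hlow i hi], fun n hn hun => ?_⟩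
  -- The truncation of the solution below order n, which is the series the recursion evaluates.
  set p : F⟦X⟧ := mk fun i => if _h : i < n then b i else 0 with hp
  have hbn : b n = -(u n)⁻¹ * coeff (n + d) (Φ p) := by
    rw [hb, triangularCoeff, if_neg (by omega)]
  have key := hΦ n hn (mk b) p (fun i hi => by rw [coeff_mk, hlow i hi])
    (fun i hi => by rw [hp, coeff_mk, dif_pos (by omega), hlow i hi])
    (X_pow_dvd_iff.2 fun i hi => by rw [map_sub, hp, coeff_mk, coeff_mk, dif_pos hi, sub_self])
  have hpn : coeff n p = 0 := by rw [hp, coeff_mk, dif_neg (lt_irrefl n)]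
  rw [hpn, coeff_mk, hbn] at key
  field_simp at key
  linear_combination key

end Recursion

/-! ### The formal normal form and the uniqueness of its parameter. -/

section Normalization

variable {F : Type*} [Field F]

lemma X_pow_dvd_normalForm_sub_X (d : ℕ) (μ : F) : X ^ (d + 1) ∣ normalForm (d + 1) μ - X := by
  refine ⟨1 + C μ * X ^ d, ?_⟩
  rw [normalForm, show 2 * (d + 1) - 1 = d + 1 + d by omega]
  ring

lemma coeff_normalForm {d : ℕ} (hd : 1 ≤ d) (μ : F) : coeff (d + 1) (normalForm (d + 1) μ) = 1 := by
  rw [normalForm, map_add, map_add, coeff_X, if_neg (by omega), coeff_X_pow_self, coeff_C_mul,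
    coeff_X_pow, if_neg (by omega)]
  ring

/-- Every `x + x ^ (d + 1) + ⋯` is formally conjugate to a normal form. -/
lemma exists_comp_eq_normalForm_comp [CharZero F] {f : F⟦X⟧} {d : ℕ} (hd : 1 ≤ d)
    (hf : X ^ (d + 1) ∣ f - X) (hf1 : coeff (d + 1) f = 1) :
    ∃ (μ : F) (h : F⟦X⟧), IsTangentToId h ∧ comp h f = comp (normalForm (d + 1) μ) h := by
  have hu : ∀ n : ℕ, n ≠ d + 1 → ((n : F) - (d + 1)) * 1 ≠ 0 := by
    intro n hn
    rw [mul_one, sub_ne_zero]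
    exact_mod_cast hn
  have step := fun (μ : F) {n : ℕ} {h h' : F⟦X⟧} => X_pow_dvd_defect_sub_defect (n := n) (h := h)
    (h' := h') hd hf hf1 (X_pow_dvd_normalForm_sub_X d μ) (coeff_normalForm hd μ)
  have step' := fun (μ : F) {n : ℕ} {h h' : F⟦X⟧} => coeff_defect_sub_defect (n := n) (h := h)
    (h' := h') hd hf hf1 (X_pow_dvd_normalForm_sub_X d μ) (coeff_normalForm hd μ)
  have hg₀ : normalForm (d + 1) (0 : F) = X + X ^ (d + 1) := by simp [normalForm]
  -- First pass, with target x + x^(d+1): every equation is solved except the resonant one, so the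
  -- defect left over is a single monomial of degree 2d + 1.
  obtain ⟨h, hlow, hsol⟩ := exists_solution_of_triangular (defect f (normalForm (d + 1) 0))
    (fun n => ((n : F) - (d + 1)) * 1) 2 d X fun n hn h h' hh _ hhh =>
      step' 0 (by simpa using hh 0 (by omega)) (by simpa using hh 1 (by omega)) hn hhh
  have h0 : coeff 0 h = 0 := by simpa using hlow 0 (by omega)
  have h1 : coeff 1 h = 1 := by simpa using hlow 1 (by omega)
  have hX : X ^ (2 + d) ∣ defect f (normalForm (d + 1) 0) X := by
    have hf0 : coeff 0 f = 0 := by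
      have := X_pow_dvd_iff.1 hf 0 (by omega)
      simpa using this
    obtain ⟨r, hr⟩ := exists_eq_X_pow_mul hf
    rw [map_sub, coeff_X, if_neg (by omega), sub_zero, hf1, map_one] at hr
    refine ⟨r, ?_⟩
    rw [defect, X_comp hf0, comp_X, hg₀]
    linear_combination hr
  have hdef : X ^ (2 + d) ∣ defect f (normalForm (d + 1) 0) h := by
    have := X_pow_dvd_of_X_pow_succ_dvd (step 0 h0 h1 le_rfl (h' := X) (X_pow_dvd_iff.2 fun i hi => by
      rw [map_sub, hlow i hi, sub_self]))
    simpa using dvd_add this hX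
  set μ := coeff (2 * d + 1) (defect f (normalForm (d + 1) 0) h) with hμ
  have hval : defect f (normalForm (d + 1) 0) h = C μ * X ^ (2 * d + 1) := by
    ext i
    rw [coeff_C_mul, coeff_X_pow]
    split_ifs with hi
    · rw [hi, mul_one]
    · rw [mul_zero]
      by_cases hi2 : i < 2 + d
      · exact X_pow_dvd_iff.1 hdef i hi2
      · have := hsol (i - d) (by omega) (hu _ (by omega))
        rwa [Nat.sub_add_cancel (by omega)] at this
  -- Adding μ x^(2d+1) to the target subtracts μ h^(2d+1) from the defect. As h is tangent to the
  -- identity, this cancels the monomial up to higher order.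
  have hdefμ : X ^ (2 * d + 2) ∣ defect f (normalForm (d + 1) μ) h := by
    have e : defect f (normalForm (d + 1) μ) h = C μ * (X ^ (2 * d + 1) - h ^ (2 * d + 1)) := by
      have : normalForm (d + 1) μ = normalForm (d + 1) 0 + C μ * X ^ (2 * d + 1) := by
        rw [hg₀, normalForm, show 2 * (d + 1) - 1 = 2 * d + 1 by omega]
      rw [defect, this, comp_add h0, comp_mul h0, comp_pow h0, C_comp, X_comp h0]
      rw [defect] at hval
      linear_combination hval
    obtain ⟨q, hq⟩ := X_dvd_of_coeff_zero h0
    have hq0 : coeff 0 q = 1 := by rw [← h1, hq]; simp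
    obtain ⟨v, hv⟩ := eq_C_add_X_mul q
    obtain ⟨s, hs⟩ := sub_dvd_pow_sub_pow q 1 (2 * d + 1)
    refine ⟨- C μ * v * s, ?_⟩
    rw [e, hq, mul_pow]
    have hv' : q - 1 = X * v := by rw [hq0, map_one] at hv; linear_combination hv
    rw [hv', one_pow] at hs
    linear_combination - C μ * X ^ (2 * d + 1) * hs
  -- Second pass, with the corrected target: keep h through the resonant degree d + 1 and solve
  -- again from d + 2 on, where no factor vanishes.
  obtain ⟨H, Hlow, Hsol⟩ := exists_solution_of_triangular (defect f (normalForm (d + 1) μ))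
    (fun n => ((n : F) - (d + 1)) * 1) (d + 2) d h fun n hn k k' hk _ hkk =>
      step' μ ((hk 0 (by omega)).trans h0) ((hk 1 (by omega)).trans h1) (by omega) hkk
  have H0 : coeff 0 H = 0 := (Hlow 0 (by omega)).trans h0
  have H1 : coeff 1 H = 1 := (Hlow 1 (by omega)).trans h1
  refine ⟨μ, H, ⟨H0, H1⟩, sub_eq_zero.1 ?_⟩
  have hdefH : X ^ (2 * d + 2) ∣ defect f (normalForm (d + 1) μ) H := by
    have := X_pow_dvd_of_X_pow_succ_dvd (step μ H0 H1 (n := d + 2) (by omega) (h' := h)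
      (X_pow_dvd_iff.2 fun i hi => by rw [map_sub, Hlow i hi, sub_self]))
    rw [show d + 2 + d = 2 * d + 2 by omega] at this
    simpa using dvd_add this hdefμ
  ext i
  rw [map_zero]
  by_cases hi2 : i < 2 * d + 2
  · exact X_pow_dvd_iff.1 hdefH i hi2
  · have := Hsol (i - d) (by omega) (hu _ (by omega))
    rwa [Nat.sub_add_cancel (by omega)] at this

/-- The parameter of a normal form is determined by its conjugacy class. -/
lemma normalForm_injective_of_comp_eq [CharZero F] {h : F⟦X⟧} {d : ℕ} (hd : 1 ≤ d) {μ μ' : F}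
    (hh : IsTangentToId h)
    (H : comp h (normalForm (d + 1) μ) = comp (normalForm (d + 1) μ') h) : μ = μ' := by
  have hf0 : coeff 0 (normalForm (d + 1) μ) = 0 := by
    have := X_pow_dvd_iff.1 (X_pow_dvd_normalForm_sub_X d μ) 0 (by omega)
    simpa using this
  have hX : defect (normalForm (d + 1) μ) (normalForm (d + 1) μ') X
      = C (μ - μ') * X ^ (2 * d + 1) := by
    rw [defect, X_comp hf0, comp_X, normalForm, normalForm,
      show 2 * (d + 1) - 1 = 2 * d + 1 by omega, map_sub]
    ring
  have hdefect : defect (normalForm (d + 1) μ) (normalForm (d + 1) μ') h = 0 := sub_eq_zero.2 H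
  -- Compare h with the identity, whose defect is (μ - μ') x^(2d+1). For n ≤ d the factor n - (d +
  -- 1) is nonzero and forces h = x + O(x^(d+1)); at n = d + 1 it vanishes and forces μ = μ'.
  have key : ∀ n, 2 ≤ n → X ^ n ∣ h - X →
      - coeff (n + d) (C (μ - μ') * X ^ (2 * d + 1)) = ((n : F) - (d + 1)) * coeff n h := by
    intro n hn hdvd
    have := coeff_defect_sub_defect hd (X_pow_dvd_normalForm_sub_X d μ) (coeff_normalForm hd μ)
      (X_pow_dvd_normalForm_sub_X d μ') (coeff_normalForm hd μ') hh.1 hh.2 hn hdvd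
    rw [hdefect, hX, coeff_X, if_neg (by omega)] at this
    simpa using this
  have hdvd : ∀ n, n ≤ d → X ^ (n + 1) ∣ h - X := by
    intro n
    induction n with
    | zero =>
      intro _
      rw [X_pow_dvd_iff]
      intro i hi
      obtain rfl : i = 0 := by omega
      rw [map_sub, hh.1]; simp
    | succ n ih =>
      intro hn
      have ih' := ih (by omega)
      rw [X_pow_dvd_iff]
      intro i hi
      rcases Nat.lt_succ_iff_lt_or_eq.1 hi with hi | rfl
      · exact X_pow_dvd_iff.1 ih' i hi
      rcases Nat.eq_zero_or_pos n with rfl | hn0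
      · rw [map_sub, hh.2, coeff_X, if_pos rfl, sub_self]
      have := key (n + 1) (by omega) ih'
      rw [coeff_C_mul, coeff_X_pow, if_neg (by omega), mul_zero, neg_zero, eq_comm,
        mul_eq_zero] at this
      rw [map_sub, coeff_X, if_neg (by omega), sub_zero]
      refine this.resolve_left (sub_ne_zero.2 ?_)
      exact_mod_cast (by omega : n + 1 ≠ d + 1)
  have := key (d + 1) (by omega) (hdvd d le_rfl)
  rw [coeff_C_mul, coeff_X_pow, if_pos (by omega), mul_one] at this
  push_cast at this
  rw [sub_self, zero_mul, neg_eq_zero, sub_eq_zero] at this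
  exact this

end Normalization

/-! ### Conjugacies, dilations and the invariance of the leading term. -/

section Conjugation

variable {F : Type*} [Field F]

/-- A nonzero multiplier supplies the compositional inverse, so from here on it suffices to handle
the inverse-free equation h ∘ f = g ∘ h. -/
lemma conjugates_of_comp_eq {h f g : F⟦X⟧} (h0 : coeff 0 h = 0) (h1 : coeff 1 h ≠ 0)
    (f0 : coeff 0 f = 0) (H : comp h f = comp g h) : Conjugates h f g := by
  have hu : IsUnit (coeff 1 h) := isUnit_iff_ne_zero.2 h1
  have hc : constantCoeff h = 0 := by simpa using h0
  have k0 : coeff 0 (substInvOfIsUnit h hu) = 0 := by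
    simp [constantCoeff_substInvOfIsUnit h hu]
  have hk : comp h (substInvOfIsUnit h hu) = X := subst_substInvOfIsUnit_right h hc hu
  refine ⟨h0, substInvOfIsUnit h hu, k0, hk, subst_substInvOfIsUnit_left h hc hu, ?_⟩
  rw [← comp_assoc f0 k0, H, comp_assoc h0 k0, hk, comp_X]

lemma Conjugates.coeff_one_ne_zero {h f g : F⟦X⟧} (H : Conjugates h f g) : coeff 1 h ≠ 0 := by
  obtain ⟨h0, k, k0, hk, -⟩ := H
  intro h1
  have := congrArg (coeff 1) hk
  rw [coeff_one_comp k0, h1, zero_mul, coeff_one_X] at this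
  exact zero_ne_one this

lemma Conjugates.comp_eq {h f g : F⟦X⟧} (H : Conjugates h f g) (f0 : coeff 0 f = 0) :
    comp h f = comp g h := by
  obtain ⟨h0, k, k0, hk, hk', rfl⟩ := H
  have fk0 : coeff 0 (comp f k) = 0 := by rw [coeff_zero_comp k0, f0]
  rw [comp_assoc fk0 h0, comp_assoc k0 h0, hk', comp_X]

/-- Semiconjugacies with `h ∘ f = g ∘ h` compose. -/
lemma comp_eq_trans {h h' f g e : F⟦X⟧} (h0 : coeff 0 h = 0) (f0 : coeff 0 f = 0)
    (g0 : coeff 0 g = 0) (h0' : coeff 0 h' = 0)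
    (H : comp h f = comp g h) (H' : comp h' g = comp e h') :
    comp (comp h' h) f = comp e (comp h' h) := by
  rw [comp_assoc h0 f0, H, ← comp_assoc g0 h0, H', comp_assoc h0' h0]

lemma Conjugates.symm_comp_eq {h f g : F⟦X⟧} (H : Conjugates h f g) (f0 : coeff 0 f = 0) :
    ∃ k : F⟦X⟧, coeff 0 k = 0 ∧ coeff 1 k ≠ 0 ∧ comp k g = comp f k := by
  obtain ⟨h0, k, k0, hk, hk', rfl⟩ := H
  have fk0 : coeff 0 (comp f k) = 0 := by rw [coeff_zero_comp k0, f0]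
  refine ⟨k, k0, ?_, ?_⟩
  · intro k1
    have := congrArg (coeff 1) hk
    rw [coeff_one_comp k0, k1, mul_zero, coeff_one_X] at this
    exact zero_ne_one this
  · rw [← comp_assoc h0 fk0, hk', X_comp fk0]

lemma coeff_zero_dilation (c : F) : coeff 0 (dilation c) = 0 := by simp [dilation]

lemma coeff_one_dilation (c : F) : coeff 1 (dilation c) = c := by simp [dilation]

lemma dilation_comp {f : F⟦X⟧} (f0 : coeff 0 f = 0) (c : F) : comp (dilation c) f = C c * f := by
  rw [dilation, comp_mul f0, C_comp, X_comp f0]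

lemma coeff_comp_dilation (f : F⟦X⟧) (c : F) (n : ℕ) :
    coeff n (comp f (dilation c)) = c ^ n * coeff n f := by
  rw [comp, dilation, ← smul_eq_C_mul, ← rescale_eq_subst, coeff_rescale]

lemma dilation_comp_dilation (b c : F) : comp (dilation b) (dilation c) = dilation (b * c) := by
  rw [dilation_comp (coeff_zero_dilation c), dilation, dilation, map_mul, mul_assoc]

lemma dilation_one : dilation (1 : F) = X := by simp [dilation]

/-- The conjugate `f(t x) / t` of `f` by a dilation. -/
noncomputable def rescaling (t : F) (f : F⟦X⟧) : F⟦X⟧ :=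
  comp (dilation t⁻¹) (comp f (dilation t))

lemma coeff_zero_comp_dilation {f : F⟦X⟧} (f0 : coeff 0 f = 0) (t : F) :
    coeff 0 (comp f (dilation t)) = 0 := by rw [coeff_zero_comp (coeff_zero_dilation t), f0]

lemma coeff_rescaling {f : F⟦X⟧} (f0 : coeff 0 f = 0) (t : F) (n : ℕ) :
    coeff n (rescaling t f) = t⁻¹ * (t ^ n * coeff n f) := by
  rw [rescaling, dilation_comp (coeff_zero_comp_dilation f0 t), coeff_C_mul, coeff_comp_dilation]

lemma coeff_succ_rescaling {f : F⟦X⟧} (f0 : coeff 0 f = 0) {t : F} (ht : t ≠ 0) (n : ℕ) :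
    coeff (n + 1) (rescaling t f) = t ^ n * coeff (n + 1) f := by
  rw [coeff_rescaling f0, pow_succ']; field_simp

lemma coeff_zero_rescaling {f : F⟦X⟧} (f0 : coeff 0 f = 0) (t : F) :
    coeff 0 (rescaling t f) = 0 := by rw [coeff_rescaling f0, f0, mul_zero, mul_zero]

lemma dilation_comp_rescaling {f : F⟦X⟧} (f0 : coeff 0 f = 0) {t : F} (ht : t ≠ 0) :
    comp (dilation t) (rescaling t f) = comp f (dilation t) := by
  have := coeff_zero_comp_dilation f0 t
  rw [rescaling, ← comp_assoc (coeff_zero_dilation _) this, dilation_comp_dilation,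
    mul_inv_cancel₀ ht, dilation_one, X_comp this]

lemma dilation_inv_comp {f : F⟦X⟧} (f0 : coeff 0 f = 0) {t : F} (ht : t ≠ 0) :
    comp (dilation t⁻¹) f = comp (rescaling t f) (dilation t⁻¹) := by
  have t0 := coeff_zero_dilation t
  have s0 := coeff_zero_dilation t⁻¹
  rw [rescaling, comp_assoc (coeff_zero_comp_dilation f0 t) s0, comp_assoc t0 s0,
    dilation_comp_dilation, mul_inv_cancel₀ ht, dilation_one, comp_X]

lemma rescaling_comp_rescaling {f g : F⟦X⟧} (f0 : coeff 0 f = 0) (g0 : coeff 0 g = 0) {t : F}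
    (ht : t ≠ 0) : comp (rescaling t f) (rescaling t g) = rescaling t (comp f g) := by
  have t0 := coeff_zero_dilation t
  have r0 := coeff_zero_rescaling g0 t
  rw [rescaling, comp_assoc (coeff_zero_comp_dilation f0 t) r0, comp_assoc t0 r0,
    dilation_comp_rescaling g0 ht, ← comp_assoc g0 t0, rescaling]

lemma X_pow_dvd_rescaling_sub_X {f : F⟦X⟧} (f0 : coeff 0 f = 0) {t : F} (ht : t ≠ 0) {n : ℕ}
    (hf : X ^ n ∣ f - X) : X ^ n ∣ rescaling t f - X := by
  rw [X_pow_dvd_iff] at hf ⊢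
  intro i hi
  have := hf i hi
  rw [map_sub, sub_eq_zero] at this ⊢
  rw [coeff_rescaling f0, this, coeff_X]
  split_ifs with h
  · subst h; field_simp
  · simp

lemma HasLeadingTerm.X_pow_dvd {f : F⟦X⟧} {m : ℕ} {a : F} (hf : HasLeadingTerm f m a) :
    X ^ m ∣ f - X := by
  obtain ⟨⟨h0, h1⟩, hm, hz, -⟩ := hf
  rw [X_pow_dvd_iff]
  intro i hi
  match i with
  | 0 => rw [map_sub, h0]; simp
  | 1 => rw [map_sub, h1]; simp
  | i + 2 => rw [map_sub, hz _ (by omega) hi, coeff_X, if_neg (by omega), sub_zero]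

lemma IsTangentToId.exists_hasLeadingTerm {f : F⟦X⟧} (hf : IsTangentToId f) (hX : f ≠ X) :
    ∃ m a, HasLeadingTerm f m a := by
  classical
  have hex : ∃ n, 1 < n ∧ coeff n f ≠ 0 := by
    by_contra! H
    refine hX (ext fun n => ?_)
    match n with
    | 0 => rw [hf.1]; simp
    | 1 => rw [hf.2]; simp
    | n + 2 => rw [H _ (by omega), coeff_X, if_neg (by omega)]
  refine ⟨Nat.find hex, _, hf, (Nat.find_spec hex).1, fun n hn hlt => ?_, rfl, (Nat.find_spec hex).2⟩
  by_contra H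
  exact Nat.find_min hex hlt ⟨hn, H⟩

lemma HasLeadingTerm.map {f : F⟦X⟧} {m : ℕ} {a : F} (hf : HasLeadingTerm f m a) {E : Type*} [Field E]
    (φ : F →+* E) : HasLeadingTerm (PowerSeries.map φ f) m (φ a) := by
  obtain ⟨⟨h0, h1⟩, hm, hz, ha, hne⟩ := hf
  refine ⟨⟨?_, ?_⟩, hm, fun n hn hnm => ?_, ?_, by simpa using hne⟩
  · rw [coeff_map, h0, map_zero]
  · rw [coeff_map, h1, map_one]
  · rw [coeff_map, hz n hn hnm, map_zero]
  · rw [coeff_map, ha]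

/-- The order of contact with the identity and, up to a power of the multiplier, the leading
coefficient are invariant under conjugation. -/
lemma HasLeadingTerm.eq_of_comp_eq {f g h : F⟦X⟧} {m m' : ℕ} {a a' : F}
    (hf : HasLeadingTerm f m a) (hg : HasLeadingTerm g m' a') (h0 : coeff 0 h = 0)
    (h1 : coeff 1 h ≠ 0) (H : comp h f = comp g h) :
    m = m' ∧ a * coeff 1 h = a' * coeff 1 h ^ m := by
  set c := coeff 1 h with hc
  have hfd := hf.X_pow_dvd
  have hgd := hg.X_pow_dvd
  obtain ⟨-, hm, -, hfa, ha⟩ := hf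
  obtain ⟨-, hm', -, hga, ha'⟩ := hg
  obtain ⟨d, rfl⟩ : ∃ d, m = d + 1 := ⟨m - 1, by omega⟩
  -- The series h ∘ f - h = g ∘ h - h is computed twice: its leading term is a c x^m from the left
  -- side and a' c^m' x^m' from the right.
  have A := X_pow_dvd_comp_sub_self (n := 1) (by omega) hfd
    (by simpa using X_dvd_of_coeff_zero h0 : X ^ 1 ∣ h)
  rw [hfa, ← hc, Nat.cast_one, one_mul, add_comm 1 d] at A
  obtain ⟨γ, hγ⟩ := exists_eq_X_pow_mul hgd
  have hcg : coeff m' (g - X) = a' := by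
    rw [map_sub, coeff_X, if_neg (by omega), sub_zero, hga]
  rw [hcg] at hγ
  obtain ⟨q, hq⟩ := X_dvd_of_coeff_zero h0
  have hq0 : coeff 0 q = c := by rw [hc, hq]; simp
  set r := q ^ m' * comp (C a' + X * γ) h with hr
  have B : comp h f - h = X ^ m' * r := by
    rw [H, show g = X + X ^ m' * (C a' + X * γ) by rw [← hγ]; ring, comp_add h0, X_comp h0,
      comp_mul h0, comp_pow h0, X_comp h0, hr]
    nth_rewrite 2 [hq]
    ring
  have hr0 : coeff 0 r = c ^ m' * a' := by
    have : coeff 0 (comp (C a' + X * γ) h) = a' := by rw [coeff_zero_comp h0]; simp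
    rw [coeff_zero_eq_constantCoeff] at this hq0
    rw [hr, coeff_zero_eq_constantCoeff, map_mul, map_pow, this, hq0]
  have hcm' : coeff m' (comp h f - h) = c ^ m' * a' := by
    rw [B, ← hr0]; simpa using coeff_X_pow_mul r m' 0
  have hcm : coeff (d + 1) (comp h f - h) = a * c := coeff_eq_of_X_pow_succ_dvd A
  have hle : m' ≤ d + 1 := by
    by_contra! hlt
    have := X_pow_dvd_iff.1 (Dvd.intro r B.symm) (d + 1) hlt
    rw [hcm] at this
    exact mul_ne_zero ha h1 this
  have hge : d + 1 ≤ m' := by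
    by_contra! hlt
    have := X_pow_dvd_iff.1 (X_pow_dvd_of_X_pow_succ_dvd A) m' hlt
    rw [hcm'] at this
    exact mul_ne_zero (pow_ne_zero _ h1) ha' this
  obtain rfl : d + 1 = m' := le_antisymm hge hle
  exact ⟨rfl, by rw [← hcm, hcm', mul_comm]⟩

lemma hasLeadingTerm_normalForm {m : ℕ} (hm : 2 ≤ m) (μ : F) :
    HasLeadingTerm (normalForm m μ) m 1 := by
  obtain ⟨d, rfl⟩ : ∃ d, m = d + 1 := ⟨m - 1, by omega⟩
  have key : ∀ i < d + 1, coeff i (normalForm (d + 1) μ) = coeff i (X : F⟦X⟧) := fun i hi => by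
    have := X_pow_dvd_iff.1 (X_pow_dvd_normalForm_sub_X d μ) i hi
    rwa [map_sub, sub_eq_zero] at this
  refine ⟨⟨?_, ?_⟩, hm, fun n hn hnm => ?_, coeff_normalForm (by omega) μ, one_ne_zero⟩
  · rw [key 0 (by omega)]; simp
  · rw [key 1 (by omega)]; simp
  · rw [key n hnm, coeff_X, if_neg (by omega)]

/-- Conjugate normal forms agree. -/
lemma normalForm_injective [CharZero F] {h : F⟦X⟧} {m : ℕ} (hm : 2 ≤ m) {μ μ' : F}
    (h0 : coeff 0 h = 0) (h1 : coeff 1 h ≠ 0)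
    (H : comp h (normalForm m μ) = comp (normalForm m μ') h) : μ = μ' := by
  have hμ := hasLeadingTerm_normalForm hm μ
  have hμ' := hasLeadingTerm_normalForm hm μ'
  have hc := (hμ.eq_of_comp_eq hμ' h0 h1 H).2
  rw [one_mul, one_mul] at hc
  obtain ⟨d, rfl⟩ : ∃ d, m = d + 1 := ⟨m - 1, by omega⟩
  set c := coeff 1 h with hcdef
  have hcd : c ^ d = 1 := by
    rw [pow_succ] at hc
    exact (mul_right_cancel₀ h1 (by rw [one_mul]; exact hc)).symm
  have hn0 := hμ.1.1
  have hn0' := hμ'.1.1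
  -- The exponents 1, d + 1, 2d + 1 are all 1 modulo d and c^d = 1, so dilation by c preserves the
  -- normal form. This allows h to be made tangent to the identity.
  have hinv : rescaling c (normalForm (d + 1) μ') = normalForm (d + 1) μ' := by
    ext i
    rcases i with _ | i
    · rw [coeff_zero_rescaling hn0', hn0']
    rw [coeff_succ_rescaling hn0' h1, normalForm, show 2 * (d + 1) - 1 = 2 * d + 1 by omega]
    simp only [map_add, coeff_C_mul, coeff_X, coeff_X_pow]
    by_cases hi0 : i = 0
    · simp [hi0]
    by_cases hid : i = d
    · simp [hid, hcd]
    by_cases hid2 : i = 2 * d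
    · rw [hid2, mul_comm 2 d, pow_mul, hcd]; simp
    · rw [if_neg (by omega), if_neg (by omega), if_neg (by omega)]; simp
  refine normalForm_injective_of_comp_eq (h := comp (dilation c⁻¹) h) (by omega) ⟨?_, ?_⟩
    (comp_eq_trans h0 hn0 hn0' (coeff_zero_dilation _) H ?_)
  · rw [coeff_zero_comp h0, coeff_zero_dilation]
  · rw [coeff_one_comp h0, coeff_one_dilation, ← hcdef, inv_mul_cancel₀ h1]
  · rw [dilation_inv_comp hn0' h1, hinv]

end Conjugation

/-! ### Lower bound for the norms of factorials. -/

section Factorial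

variable {F : Type*} [NormedField F] [IsUltrametricDist F]

/-- If |u| < 1 as well, a Bézout relation would write 1 as a sum of two elements of norm less than
1. -/
lemma norm_natCast_eq_one_of_coprime {p u : ℕ} (hp : ‖(p : F)‖ < 1) (h : p.Coprime u) :
    ‖(u : F)‖ = 1 := by
  refine le_antisymm (IsUltrametricDist.norm_natCast_le_one F u) ?_
  by_contra! hu
  have hb : ((p : F) * (Nat.gcdA p u : ℤ) + (u : F) * (Nat.gcdB p u : ℤ)) = 1 := by
    have := Nat.gcd_eq_gcd_ab p u
    rw [Nat.Coprime.gcd_eq_one h] at this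
    have hz : (((p : ℤ) * Nat.gcdA p u + u * Nat.gcdB p u : ℤ) : F) = 1 := by
      rw [← this]; simp
    exact_mod_cast hz
  have h1 : ‖(p : F) * (Nat.gcdA p u : ℤ)‖ < 1 := by
    rw [norm_mul]
    exact (mul_le_of_le_one_right (norm_nonneg _)
      (IsUltrametricDist.norm_intCast_le_one F _)).trans_lt hp
  have h2 : ‖(u : F) * (Nat.gcdB p u : ℤ)‖ < 1 := by
    rw [norm_mul]
    exact (mul_le_of_le_one_right (norm_nonneg _)
      (IsUltrametricDist.norm_intCast_le_one F _)).trans_lt hu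
  have := IsUltrametricDist.norm_add_le_max ((p : F) * (Nat.gcdA p u : ℤ))
    ((u : F) * (Nat.gcdB p u : ℤ))
  rw [hb, norm_one] at this
  exact absurd (this.trans_lt (max_lt h1 h2)) (lt_irrefl _)

/-- Factorials decay at most geometrically in a non-archimedean field of characteristic `0`. -/
lemma exists_pow_le_norm_factorial [CharZero F] :
    ∃ c : ℝ, 0 < c ∧ c ≤ 1 ∧ ∀ n : ℕ, c ^ n ≤ ‖(n.factorial : F)‖ := by
  -- If some prime p has norm less than 1, then |n!| is |p| to the power v_p(n!) ≤ n, and c = |p|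
  -- works. Otherwise every nonzero integer has norm at least 1, and c = 1 works.
  by_cases hex : ∃ p : ℕ, p.Prime ∧ ‖(p : F)‖ < 1
  · obtain ⟨p, hp, hlt⟩ := hex
    have hfact : Fact p.Prime := ⟨hp⟩
    refine ⟨‖(p : F)‖, norm_pos_iff.2 (Nat.cast_ne_zero.2 hp.ne_zero), hlt.le, fun n => ?_⟩
    obtain ⟨k, u, hpu, hk⟩ := Nat.exists_eq_pow_mul_and_not_dvd n.factorial_ne_zero p hp.ne_one
    have hkn : k ≤ n := by
      rcases Nat.eq_zero_or_pos n with rfl | hn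
      · by_contra! hk0
        have : p ∣ Nat.factorial 0 := hk ▸ Dvd.dvd.mul_right (dvd_pow_self p (by omega)) u
        exact hp.one_lt.ne' (Nat.dvd_one.1 (by simpa using this))
      · refine le_trans ?_ (padicValNat_factorial_lt_of_ne_zero p hn.ne').le
        exact (padicValNat_dvd_iff_le n.factorial_ne_zero).1 ⟨u, hk⟩
    rw [hk, Nat.cast_mul, Nat.cast_pow, norm_mul, norm_pow,
      norm_natCast_eq_one_of_coprime hlt ((Nat.Prime.coprime_iff_not_dvd hp).2 hpu), mul_one]
    exact pow_le_pow_of_le_one (norm_nonneg _) hlt.le hkn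
  · push Not at hex
    have key : ∀ n : ℕ, n ≠ 0 → 1 ≤ ‖(n : F)‖ := by
      intro n
      induction n using Nat.recOnMul with
      | zero => intro h; exact absurd rfl h
      | one => intro _; simp
      | prime p hp => intro _; exact hex p hp
      | mul a b iha ihb =>
        intro h
        rw [Nat.cast_mul, norm_mul]
        exact one_le_mul_of_one_le_of_one_le (iha (left_ne_zero_of_mul h))
          (ihb (right_ne_zero_of_mul h))
    exact ⟨1, one_pos, le_rfl, fun n => by rw [one_pow]; exact key _ n.factorial_ne_zero⟩

end Factorial

/-! ### Growth of the coefficients of a conjugacy. -/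

section Bounds

variable {F : Type*} [NormedField F] [IsUltrametricDist F]

lemma norm_sum_mul_le_one {ι : Type*} {s : Finset ι} {f : ι → F} {A : ℝ} (hA : 0 < A)
    (h : ∀ i ∈ s, ‖f i‖ * A ≤ 1) : ‖∑ i ∈ s, f i‖ * A ≤ 1 := by
  rw [← le_div_iff₀ hA]
  exact IsUltrametricDist.norm_sum_le_of_forall_le_of_nonneg (by positivity)
    fun i hi => (le_div_iff₀ hA).2 (h i hi)

lemma norm_coeff_pow_le_one {f : F⟦X⟧} (hf : ∀ n, ‖coeff n f‖ ≤ 1) (k n : ℕ) :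
    ‖coeff n (f ^ k)‖ ≤ 1 := by
  induction k generalizing n with
  | zero => rw [pow_zero, coeff_one]; split_ifs <;> simp
  | succ k ih =>
    rw [pow_succ, coeff_mul]
    refine IsUltrametricDist.norm_sum_le_of_forall_le_of_nonneg zero_le_one fun i _ => ?_
    rw [norm_mul]
    exact mul_le_one₀ (ih _) (norm_nonneg _) (hf _)

/-- Powers of a polynomial of degree at most `N` satisfy the same bounds as the polynomial, and the
bound at degree `N + 1` is that at degree `N`. -/
lemma norm_coeff_pow_mul_le {D : ℕ → ℝ} (hD : ∀ n, 0 < D n) (hD0 : D 0 = 1) (hanti : Antitone D)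
    (hmul : ∀ i j, D (i + j) ≤ D i * D j) {q : F⟦X⟧} {N d : ℕ} (hd : 1 ≤ d)
    (hq : ∀ e ≤ N, ‖coeff e q‖ * D (e - d) ≤ 1) (hqN : coeff (N + 1) q = 0) (k : ℕ) :
    ∀ E ≤ N + 1, ‖coeff E (q ^ k)‖ * D (min E N - d) ≤ 1 := by
  induction k with
  | zero =>
    intro E _
    rw [pow_zero, coeff_one]
    split_ifs
    · rw [norm_one, one_mul]; exact (hanti (Nat.zero_le _)).trans hD0.le
    · rw [norm_zero, zero_mul]; exact zero_le_one
  | succ k ih =>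
    intro E hE
    rw [pow_succ', coeff_mul]
    refine norm_sum_mul_le_one (hD _) fun ij hij => ?_
    obtain ⟨i, j⟩ := ij
    rw [Finset.HasAntidiagonal.mem_antidiagonal] at hij
    simp only at hij ⊢
    by_cases hi : i = N + 1
    · rw [hi, hqN, zero_mul, norm_zero, zero_mul]; exact zero_le_one
    -- When both i, j ≥ d, splitting the degree loses d twice instead of once. As d ≥ 1, this pays
    -- for the missing unit at E = N + 1. The case i = N + 1 was removed because that coefficient of
    -- q is 0.
    have hle : D (min E N - d) ≤ D (i - d) * D (min j N - d) :=
      (hanti (by omega)).trans (hmul _ _)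
    calc ‖coeff i q * coeff j (q ^ k)‖ * D (min E N - d)
        ≤ ‖coeff i q * coeff j (q ^ k)‖ * (D (i - d) * D (min j N - d)) := by gcongr
      _ = (‖coeff i q‖ * D (i - d)) * (‖coeff j (q ^ k)‖ * D (min j N - d)) := by
        rw [norm_mul]; ring
      _ ≤ 1 := mul_le_one₀ (hq i (by omega))
        (mul_nonneg (norm_nonneg _) (hD _).le) (ih j (by omega))

/-- Binomial coefficients have norm at most 1. This submultiplicativity is what carries the weights
through products of series. -/
lemma norm_pow_mul_factorial_add_le {a : F} (i j : ℕ) :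
    ‖a ^ (i + j) * ((i + j).factorial : F)‖ ≤
      ‖a ^ i * (i.factorial : F)‖ * ‖a ^ j * (j.factorial : F)‖ := by
  obtain ⟨k, hk⟩ := Nat.factorial_mul_factorial_dvd_factorial_add i j
  rw [hk, ← norm_mul]
  push_cast
  rw [show a ^ (i + j) * ((i.factorial : F) * j.factorial * k) =
    a ^ i * i.factorial * (a ^ j * j.factorial) * k by ring, norm_mul]
  exact mul_le_of_le_one_right (norm_nonneg _) (IsUltrametricDist.norm_natCast_le_one F k)

/-- The coefficients of a conjugacy between series with integral coefficients grow at most like the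
inverses of factorials. -/
theorem norm_coeff_mul_le_one_of_comp_eq [CharZero F] {f g h : F⟦X⟧} {d : ℕ} {a : F} (hd : 1 ≤ d)
    (hfX : X ^ (d + 1) ∣ f - X) (hfa : coeff (d + 1) f = a)
    (hgX : X ^ (d + 1) ∣ g - X) (hga : coeff (d + 1) g = a) (ha : a ≠ 0)
    (hf : ∀ n, ‖coeff n f‖ ≤ 1) (hg : ∀ n, ‖coeff n g‖ ≤ 1)
    (hh : IsTangentToId h) (hhlow : ∀ n ≤ d + 1, ‖coeff n h‖ ≤ 1) (H : comp h f = comp g h)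
    (n : ℕ) : ‖coeff n h‖ * ‖a ^ (n - (d + 1)) * ((n - (d + 1)).factorial : F)‖ ≤ 1 := by
  have ha1 : ‖a‖ ≤ 1 := hfa ▸ hf (d + 1)
  obtain ⟨D, hDdef⟩ : ∃ D : ℕ → ℝ, ∀ k, D k = ‖a ^ k * (k.factorial : F)‖ := ⟨_, fun _ => rfl⟩
  have hDpos : ∀ k, 0 < D k := fun k => by
    rw [hDdef]
    exact norm_pos_iff.2 (mul_ne_zero (pow_ne_zero _ ha) (Nat.cast_ne_zero.2 k.factorial_ne_zero))
  have hD0 : D 0 = 1 := by simp [hDdef]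
  have hDmul : ∀ i j, D (i + j) ≤ D i * D j := fun i j => by
    simp only [hDdef]; exact norm_pow_mul_factorial_add_le i j
  have hDle : ∀ k, D k ≤ 1 := fun k => by
    rw [hDdef, norm_mul, norm_pow]
    exact mul_le_one₀ (pow_le_one₀ (norm_nonneg _) ha1) (norm_nonneg _)
      (IsUltrametricDist.norm_natCast_le_one F _)
  have hanti : Antitone D := fun i j hij => by
    obtain ⟨k, rfl⟩ := Nat.exists_eq_add_of_le hij
    exact (hDmul i k).trans (mul_le_of_le_one_right (hDpos i).le (hDle k))
  have hf0 : coeff 0 f = 0 := by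
    have := X_pow_dvd_iff.1 hfX 0 (by omega)
    simpa using this
  rw [← hDdef]
  induction n using Nat.strong_induction_on with
  | _ n ih =>
  by_cases hn : n ≤ d + 1
  · rw [Nat.sub_eq_zero_of_le hn, hD0, mul_one]; exact hhlow n hn
  obtain ⟨N, rfl⟩ : ∃ N, n = N + 2 := ⟨n - 2, by omega⟩
  -- Truncating h below n = N + 2 isolates its n-th coefficient: since h has zero defect, (n - (d +
  -- 1)) a h_n is minus the coefficient of order n + d in the defect of p, which the induction
  -- hypothesis controls.
  obtain ⟨p, hp⟩ : ∃ p : F⟦X⟧, ∀ i, coeff i p = if i < N + 2 then coeff i h else 0 :=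
    ⟨mk fun i => if i < N + 2 then coeff i h else 0, fun i => coeff_mk _ _⟩
  have hp0 : coeff 0 p = 0 := by rw [hp, if_pos (by omega), hh.1]
  have hpb : ∀ i, ‖coeff i p‖ * D (i - (d + 1)) ≤ 1 := fun i => by
    rw [hp]
    split_ifs with hi
    · exact ih i hi
    · rw [norm_zero, zero_mul]; exact zero_le_one
  have key := coeff_defect_sub_defect hd hfX hfa hgX hga hh.1 hh.2 (n := N + 2) (by omega)
    (h' := p) (X_pow_dvd_iff.2 fun i hi => by rw [map_sub, hp, if_pos hi, sub_self])
  rw [show defect f g h = 0 from sub_eq_zero.2 H, hp, if_neg (lt_irrefl _), map_zero, zero_sub,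
    sub_zero] at key
  have hfp : ‖coeff (N + 2 + d) (comp p f)‖ * D (N - d) ≤ 1 := by
    rw [coeff_comp hf0]
    refine norm_sum_mul_le_one (hDpos _) fun k _ => ?_
    by_cases hk : k < N + 2
    · rw [norm_mul, mul_right_comm]
      refine mul_le_one₀ (le_trans ?_ (hpb k)) (norm_nonneg _) (norm_coeff_pow_le_one hf _ _)
      exact mul_le_mul_of_nonneg_left (hanti (by omega)) (norm_nonneg _)
    · rw [hp, if_neg hk, zero_mul, norm_zero, zero_mul]; exact zero_le_one
  have hgp : ‖coeff (N + 2 + d) (comp g p)‖ * D (N - d) ≤ 1 := by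
    obtain ⟨q, hq⟩ := X_dvd_of_coeff_zero hp0
    have hqc : ∀ e, coeff e q = coeff (e + 1) p := fun e => by rw [hq, coeff_succ_X_mul]
    have hqpow := fun k => norm_coeff_pow_mul_le hDpos hD0 hanti hDmul hd (q := q) (N := N)
      (fun e _ => by
        rw [hqc]
        have := hpb (e + 1)
        rwa [show e + 1 - (d + 1) = e - d by omega] at this)
      (by rw [hqc, hp, if_neg (lt_irrefl _)]) k
    rw [coeff_comp hp0]
    refine norm_sum_mul_le_one (hDpos _) fun k hk => ?_
    rw [Finset.mem_range] at hk
    by_cases hk0 : k = 0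
    · rw [hk0, pow_zero, coeff_one, if_neg (by omega), mul_zero, norm_zero, zero_mul]
      exact zero_le_one
    by_cases hk1 : k = 1
    · rw [hk1, pow_one, hp, if_neg (by omega), mul_zero, norm_zero, zero_mul]
      exact zero_le_one
    by_cases hkd : k < d + 1
    · have := X_pow_dvd_iff.1 hgX k hkd
      rw [map_sub, coeff_X, if_neg hk1, sub_zero] at this
      rw [this, zero_mul, norm_zero, zero_mul]
      exact zero_le_one
    -- Only k ≥ d + 1 remains, so the degree in q^k is at most N + 1, the range covered by
    -- `norm_coeff_pow_mul_le`.
    have hck : coeff (N + 2 + d) (p ^ k) = coeff (N + 2 + d - k) (q ^ k) := by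
      rw [hq, mul_pow]
      conv_lhs => rw [show N + 2 + d = (N + 2 + d - k) + k by omega]
      exact coeff_X_pow_mul _ _ _
    rw [hck, norm_mul, mul_assoc]
    refine mul_le_one₀ (hg k) (mul_nonneg (norm_nonneg _) (hDpos _).le)
      (le_trans ?_ (hqpow k (N + 2 + d - k) (by omega)))
    exact mul_le_mul_of_nonneg_left (hanti (by omega)) (norm_nonneg _)
  have hdef : ‖coeff (N + 2 + d) (defect f g p)‖ * D (N - d) ≤ 1 := by
    rw [defect, map_sub]
    have hsub := IsUltrametricDist.norm_add_le_max (coeff (N + 2 + d) (comp p f))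
      (-coeff (N + 2 + d) (comp g p))
    rw [norm_neg, ← sub_eq_add_neg] at hsub
    refine le_trans (mul_le_mul_of_nonneg_right hsub (hDpos _).le) ?_
    rw [max_mul_of_nonneg _ _ (hDpos _).le]
    exact max_le hfp hgp
  have hN : N + 2 - (d + 1) = N - d + 1 := by omega
  have hcast : (((N + 2 : ℕ) : F) - (d + 1)) = ((N - d + 1 : ℕ) : F) := by
    rw [← hN, Nat.cast_sub (by omega)]; push_cast; ring
  rw [hcast] at key
  -- The weights were chosen so that one step of the recursion costs exactly its divisor (n - (d +
  -- 1)) a.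
  have hDs : D (N + 2 - (d + 1)) = D (N - d) * ‖((N - d + 1 : ℕ) : F) * a‖ := by
    rw [hN, hDdef, hDdef, ← norm_mul, Nat.factorial_succ]
    push_cast
    congr 1
    ring
  rw [hDs, show ‖coeff (N + 2) h‖ * (D (N - d) * ‖((N - d + 1 : ℕ) : F) * a‖) =
    ‖((N - d + 1 : ℕ) : F) * a * coeff (N + 2) h‖ * D (N - d) by
      rw [norm_mul (_ * a)]; ring, ← key, norm_neg]
  exact hdef

end Bounds

/-! ### Positive radius of convergence and automatic convergence of conjugacies. -/

section LocallyAnalytic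

variable {F : Type*} [NormedField F]

lemma locallyAnalytic_of_eventually_le {f : F⟦X⟧} {R : ℝ} (hR : 0 ≤ R)
    (h : ∀ᶠ n in atTop, ‖coeff n f‖ ≤ R ^ n) : LocallyAnalytic f := by
  rw [LocallyAnalytic, convergenceRadius, ENNReal.inv_pos]
  refine ne_top_of_le_ne_top (ENNReal.ofReal_ne_top (r := R)) (limsup_le_of_le (by isBoundedDefault) ?_)
  filter_upwards [h, eventually_gt_atTop 0] with n hn hn0
  have hn0' : (0 : ℝ) < n := Nat.cast_pos.2 hn0
  rw [one_div, ENNReal.rpow_inv_le_iff hn0', ENNReal.rpow_natCast, ← ENNReal.ofReal_pow hR,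
    ← ofReal_norm]
  exact ENNReal.ofReal_le_ofReal hn

/-- The finitely many coefficients not covered by the limsup are absorbed into the base R. Degree 0
is excluded because R^0 = 1 need not bound the constant term. -/
lemma LocallyAnalytic.exists_bound {f : F⟦X⟧} (hf : LocallyAnalytic f) :
    ∃ R : ℝ, 1 ≤ R ∧ ∀ n, 1 ≤ n → ‖coeff n f‖ ≤ R ^ n := by
  rw [LocallyAnalytic, convergenceRadius, ENNReal.inv_pos, ← lt_top_iff_ne_top] at hf
  obtain ⟨r, hr, -⟩ := ENNReal.lt_iff_exists_nnreal_btwn.1 hf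
  obtain ⟨N, hN⟩ := eventually_atTop.1 (eventually_lt_of_limsup_lt hr)
  have hsum : 0 ≤ ∑ i ∈ Finset.range N, ‖coeff i f‖ := Finset.sum_nonneg fun _ _ => norm_nonneg _
  refine ⟨1 + r + ∑ i ∈ Finset.range N, ‖coeff i f‖, by linarith [r.coe_nonneg], fun n hn => ?_⟩
  have h1 : 1 ≤ 1 + r + ∑ i ∈ Finset.range N, ‖coeff i f‖ := by linarith [r.coe_nonneg]
  by_cases hnN : n < N
  · have : ‖coeff n f‖ ≤ ∑ i ∈ Finset.range N, ‖coeff i f‖ :=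
      Finset.single_le_sum (f := fun i => ‖coeff i f‖) (fun _ _ => norm_nonneg _)
        (Finset.mem_range.2 hnN)
    exact (by linarith [r.coe_nonneg] : ‖coeff n f‖ ≤ _).trans (le_self_pow₀ h1 (by omega))
  · have hn' := (hN n (by omega)).le
    have hn0' : (0 : ℝ) < n := Nat.cast_pos.2 hn
    rw [one_div, ENNReal.rpow_inv_le_iff hn0', ENNReal.rpow_natCast, enorm_eq_nnnorm,
      ← ENNReal.coe_pow, ENNReal.coe_le_coe, ← NNReal.coe_le_coe, NNReal.coe_pow,
      coe_nnnorm] at hn'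
    exact hn'.trans (pow_le_pow_left₀ r.coe_nonneg (by linarith) n)

lemma LocallyAnalytic.of_coeff_le {f g : F⟦X⟧} (hf : LocallyAnalytic f) {A : ℝ} (hA : 0 ≤ A)
    (h : ∀ n, 1 ≤ n → ‖coeff n g‖ ≤ A ^ n * ‖coeff n f‖) : LocallyAnalytic g := by
  obtain ⟨R, hR, hfR⟩ := hf.exists_bound
  refine locallyAnalytic_of_eventually_le (R := A * R) (by positivity) ?_
  filter_upwards [eventually_ge_atTop 1] with n hn
  rw [mul_pow]
  exact (h n hn).trans (mul_le_mul_of_nonneg_left (hfR n hn) (by positivity))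

lemma LocallyAnalytic.C_mul {f : F⟦X⟧} (hf : LocallyAnalytic f) (c : F) :
    LocallyAnalytic (C c * f) := by
  refine hf.of_coeff_le (A := 1 + ‖c‖) (by positivity) fun n hn => ?_
  rw [coeff_C_mul, norm_mul]
  refine mul_le_mul_of_nonneg_right ?_ (norm_nonneg _)
  exact (by linarith : ‖c‖ ≤ 1 + ‖c‖).trans
    (le_self_pow₀ (by linarith [norm_nonneg c]) (by omega))

lemma LocallyAnalytic.comp_dilation {f : F⟦X⟧} (hf : LocallyAnalytic f) (c : F) :
    LocallyAnalytic (comp f (dilation c)) := by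
  refine hf.of_coeff_le (A := ‖c‖) (by positivity) fun n hn => ?_
  rw [coeff_comp_dilation, norm_mul, norm_pow]

lemma LocallyAnalytic.rescaling {f : F⟦X⟧} (hf : LocallyAnalytic f) (f0 : coeff 0 f = 0) (c : F) :
    LocallyAnalytic (rescaling c f) := by
  rw [TangentToIdentity.rescaling, dilation_comp (coeff_zero_comp_dilation f0 c)]
  exact (hf.comp_dilation c).C_mul _

lemma locallyAnalytic_of_coeff_eq_zero {f : F⟦X⟧} {N : ℕ} (h : ∀ n, N < n → coeff n f = 0) :
    LocallyAnalytic f := by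
  refine locallyAnalytic_of_eventually_le (R := 0) le_rfl ?_
  filter_upwards [eventually_gt_atTop N] with n hn
  rw [h n hn, norm_zero]
  positivity

/-- The coefficient of degree n + 1 gains a factor t^n and is at most R^(n+1) ≤ R^(2n) for n ≥ 1, so
|t| ≤ R^(-2) suffices. Degree 1 is unaffected by t, and there tangency to the identity is used. -/
lemma LocallyAnalytic.exists_norm_coeff_rescaling_le_one {f : F⟦X⟧} (hf : LocallyAnalytic f)
    (hf1 : IsTangentToId f) :
    ∃ r > 0, ∀ t : F, t ≠ 0 → ‖t‖ ≤ r → ∀ n, ‖coeff n (TangentToIdentity.rescaling t f)‖ ≤ 1 := by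
  obtain ⟨R, hR, hfR⟩ := hf.exists_bound
  refine ⟨(R ^ 2)⁻¹, by positivity, fun t ht htr n => ?_⟩
  rcases n with _ | n
  · rw [coeff_zero_rescaling hf1.1, norm_zero]; exact zero_le_one
  rw [coeff_succ_rescaling hf1.1 ht, norm_mul, norm_pow]
  rcases Nat.eq_zero_or_pos n with rfl | hn
  · rw [zero_add, hf1.2]; simp
  have h2 : ‖coeff (n + 1) f‖ ≤ (R ^ 2) ^ n := by
    rw [← pow_mul]
    exact (hfR _ (by omega)).trans (pow_le_pow_right₀ hR (by omega))
  calc ‖t‖ ^ n * ‖coeff (n + 1) f‖ ≤ ((R ^ 2)⁻¹) ^ n * (R ^ 2) ^ n := by gcongr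
    _ = 1 := by rw [← mul_pow, inv_mul_cancel₀ (by positivity), one_pow]

lemma exists_norm_coeff_rescaling_le_one {h : F⟦X⟧} (hh : IsTangentToId h) (N : ℕ) :
    ∃ r > 0, ∀ t : F, t ≠ 0 → ‖t‖ ≤ r → ∀ n ≤ N, ‖coeff n (rescaling t h)‖ ≤ 1 := by
  -- A truncation is a polynomial, hence locally analytic; cutting at N + 1 keeps the linear term
  -- even for N = 0.
  obtain ⟨p, hp⟩ : ∃ p : F⟦X⟧, ∀ i, coeff i p = if i ≤ N + 1 then coeff i h else 0 :=
    ⟨mk fun i => if i ≤ N + 1 then coeff i h else 0, fun i => coeff_mk _ _⟩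
  have hpt : IsTangentToId p :=
    ⟨by rw [hp, if_pos (by omega), hh.1], by rw [hp, if_pos (by omega), hh.2]⟩
  obtain ⟨r, hr, hrt⟩ := (locallyAnalytic_of_coeff_eq_zero (N := N + 1) fun n hn => by
    rw [hp, if_neg (by omega)]).exists_norm_coeff_rescaling_le_one hpt
  refine ⟨r, hr, fun t ht htr n hn => ?_⟩
  have := hrt t ht htr n
  rwa [coeff_rescaling hpt.1, hp, if_pos (by omega), ← coeff_rescaling hh.1] at this

/-- Every formal conjugacy, tangent to the identity, between locally analytic series is locally
analytic. -/
theorem locallyAnalytic_of_comp_eq [IsUltrametricDist F] [CharZero F]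
    (hF : ∃ t : F, t ≠ 0 ∧ ‖t‖ < 1) {f g h : F⟦X⟧} {m : ℕ} {a : F}
    (hf : LocallyAnalytic f) (hg : LocallyAnalytic g) (hfm : HasLeadingTerm f m a)
    (hgm : HasLeadingTerm g m a) (hh : IsTangentToId h) (H : comp h f = comp g h) :
    LocallyAnalytic h := by
  obtain ⟨d, rfl⟩ : ∃ d, m = d + 1 := ⟨m - 1, by have := hfm.2.1; omega⟩
  have hd : 1 ≤ d := by have := hfm.2.1; omega
  obtain ⟨r₁, hr₁, hfr⟩ := hf.exists_norm_coeff_rescaling_le_one hfm.1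
  obtain ⟨r₂, hr₂, hgr⟩ := hg.exists_norm_coeff_rescaling_le_one hgm.1
  obtain ⟨r₃, hr₃, hhr⟩ := exists_norm_coeff_rescaling_le_one hh (d + 1)
  -- One dilation makes f, g and the coefficients of h up to the resonant degree integral at once.
  obtain ⟨t, ht, ht1, htr₁, htr₂, htr₃⟩ : ∃ t : F, t ≠ 0 ∧ ‖t‖ ≤ 1 ∧ ‖t‖ ≤ r₁ ∧ ‖t‖ ≤ r₂ ∧
      ‖t‖ ≤ r₃ := by
    obtain ⟨s, hs, hs1⟩ := hF
    obtain ⟨k, hk⟩ := exists_pow_lt_of_lt_one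
      (show 0 < min 1 (min r₁ (min r₂ r₃)) by positivity) hs1
    refine ⟨s ^ k, pow_ne_zero _ hs, ?_⟩
    rw [norm_pow]
    simp only [lt_min_iff] at hk
    exact ⟨hk.1.le, hk.2.1.le, hk.2.2.1.le, hk.2.2.2.le⟩
  have ha : a ≠ 0 := hfm.2.2.2.2
  have hta : t ^ d * a ≠ 0 := mul_ne_zero (pow_ne_zero _ ht) ha
  have bound := norm_coeff_mul_le_one_of_comp_eq hd
    (X_pow_dvd_rescaling_sub_X hfm.1.1 ht hfm.X_pow_dvd)
    (by rw [coeff_succ_rescaling hfm.1.1 ht, hfm.2.2.2.1])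
    (X_pow_dvd_rescaling_sub_X hgm.1.1 ht hgm.X_pow_dvd)
    (by rw [coeff_succ_rescaling hgm.1.1 ht, hgm.2.2.2.1]) hta
    (hfr t ht htr₁) (hgr t ht htr₂) (h := rescaling t h)
    ⟨coeff_zero_rescaling hh.1 t, by rw [coeff_succ_rescaling hh.1 ht, zero_add, hh.2]; simp⟩
    (hhr t ht htr₃)
    (by rw [rescaling_comp_rescaling hh.1 hfm.1.1 ht, H, rescaling_comp_rescaling hgm.1.1 hh.1 ht])
  obtain ⟨c, hc, hc1, hfac⟩ := exists_pow_le_norm_factorial (F := F)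
  have hta1 : ‖t ^ d * a‖ ≤ 1 := by
    have := hfr t ht htr₁ (d + 1)
    rwa [coeff_succ_rescaling hfm.1.1 ht, hfm.2.2.2.1] at this
  have hb0 : 0 < ‖t ^ d * a‖ * c := mul_pos (norm_pos_iff.2 hta) hc
  have hb1 : ‖t ^ d * a‖ * c ≤ 1 := mul_le_one₀ hta1 hc.le hc1
  have hanalytic : LocallyAnalytic (rescaling t h) := by
    refine locallyAnalytic_of_eventually_le (R := (‖t ^ d * a‖ * c)⁻¹) (by positivity)
      (Eventually.of_forall fun n => ?_)
    rw [inv_pow, ← one_div, le_div_iff₀ (by positivity)]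
    refine le_trans (mul_le_mul_of_nonneg_left ?_ (norm_nonneg _)) (bound n)
    calc (‖t ^ d * a‖ * c) ^ n ≤ (‖t ^ d * a‖ * c) ^ (n - (d + 1)) :=
          pow_le_pow_of_le_one hb0.le hb1 (by omega)
      _ ≤ _ := by
          rw [mul_pow, norm_mul ((t ^ d * a) ^ _), norm_pow (t ^ d * a)]
          exact mul_le_mul_of_nonneg_left (hfac _) (by positivity)
  refine hanalytic.of_coeff_le (A := ‖t‖⁻¹) (by positivity) fun n hn => ?_
  obtain ⟨n, rfl⟩ : ∃ k, n = k + 1 := ⟨n - 1, by omega⟩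
  have htp : 0 < ‖t‖ := norm_pos_iff.2 ht
  rw [coeff_succ_rescaling hh.1 ht, norm_mul, norm_pow, ← mul_assoc]
  refine le_mul_of_one_le_left (norm_nonneg _) ?_
  rw [pow_succ, mul_right_comm, ← mul_pow, inv_mul_cancel₀ htp.ne', one_pow, one_mul]
  exact (one_le_inv₀ htp).2 ht1

end LocallyAnalytic

/-! ### Normal forms, invariants, and formal versus analytic conjugacy. -/

section Classification

/-- Reduction to the normal form, for a root `α` of `α ^ (m - 1) = a`. -/
theorem exists_conjugates_normalForm {F : Type*} [NormedField F] [IsUltrametricDist F] [CharZero F]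
    (hF : ∃ t : F, t ≠ 0 ∧ ‖t‖ < 1) {f : F⟦X⟧} {m : ℕ} {a α : F} (hf : LocallyAnalytic f)
    (hfm : HasLeadingTerm f m a) (hα : α ^ (m - 1) = a) :
    ∃ (μ : F) (h : F⟦X⟧), LocallyAnalytic h ∧ IsTangentToId h ∧
      Conjugates (comp h (dilation α)) f (normalForm m μ) := by
  have hm := hfm.2.1
  obtain ⟨d, rfl⟩ : ∃ d, m = d + 1 := ⟨m - 1, by omega⟩
  rw [Nat.add_sub_cancel] at hα
  have ha : a ≠ 0 := hfm.2.2.2.2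
  have hα0 : α ≠ 0 := by
    rintro rfl
    rw [zero_pow (by omega)] at hα
    exact ha hα.symm
  have f0 := hfm.1.1
  -- Conjugating by x ↦ α x divides the leading coefficient by α^d = a.
  have hc1 : coeff (d + 1) (rescaling α⁻¹ f) = 1 := by
    rw [coeff_succ_rescaling f0 (inv_ne_zero hα0), hfm.2.2.2.1, inv_pow, hα, inv_mul_cancel₀ ha]
  have hdvd := X_pow_dvd_rescaling_sub_X f0 (inv_ne_zero hα0) hfm.X_pow_dvd
  have hlead : HasLeadingTerm (rescaling α⁻¹ f) (d + 1) 1 := by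
    refine ⟨⟨coeff_zero_rescaling f0 _, ?_⟩, hm, fun n hn hnm => ?_, hc1, one_ne_zero⟩
    · rw [coeff_succ_rescaling f0 (inv_ne_zero hα0), zero_add, hfm.1.2]; simp
    · rw [coeff_rescaling f0, hfm.2.2.1 n hn hnm, mul_zero, mul_zero]
  obtain ⟨μ, h, hh, H⟩ := exists_comp_eq_normalForm_comp (by omega) hdvd hc1
  have hμ : LocallyAnalytic (normalForm (d + 1) μ) := by
    refine locallyAnalytic_of_coeff_eq_zero (N := 2 * d + 1) fun n hn => ?_
    rw [normalForm, show 2 * (d + 1) - 1 = 2 * d + 1 by omega]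
    simp only [map_add, coeff_C_mul, coeff_X, coeff_X_pow]
    rw [if_neg (by omega), if_neg (by omega), if_neg (by omega)]
    simp
  have hlm := hasLeadingTerm_normalForm hm μ
  refine ⟨μ, h, locallyAnalytic_of_comp_eq hF (hf.rescaling f0 _) hμ hlead hlm hh H, hh,
    conjugates_of_comp_eq ?_ ?_ f0 ?_⟩
  · exact coeff_zero_comp_dilation hh.1 α
  · rwa [coeff_one_comp (coeff_zero_dilation α), coeff_one_dilation, hh.2, one_mul]
  · refine comp_eq_trans (coeff_zero_dilation α) f0 hlead.1.1 hh.1 ?_ H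
    have := dilation_inv_comp f0 (inv_ne_zero hα0)
    rwa [inv_inv] at this

/-- Formal invariance of the order of contact with the identity and of the parameter of the normal
form. -/
theorem formal_invariants {F : Type*} [Field F] [CharZero F] {f g : F⟦X⟧} {m m' : ℕ} {a a' : F}
    (hf : HasLeadingTerm f m a) (hg : HasLeadingTerm g m' a')
    (hfg : ∃ h, Conjugates h f g) :
    m = m' ∧ ∀ μ μ' : F, (∃ h, Conjugates h f (normalForm m μ)) →
      (∃ h, Conjugates h g (normalForm m' μ')) → μ = μ' := by
  obtain ⟨h, hc⟩ := hfg
  have f0 := hf.1.1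
  have g0 := hg.1.1
  have H := hc.comp_eq f0
  obtain rfl := (hf.eq_of_comp_eq hg hc.1 hc.coeff_one_ne_zero H).1
  refine ⟨rfl, ?_⟩
  rintro μ μ' ⟨p, hp⟩ ⟨q, hq⟩
  have hm := hf.2.1
  have hμ0 := (hasLeadingTerm_normalForm hm μ).1.1
  obtain ⟨k, k0, k1, hk⟩ := hp.symm_comp_eq f0
  have hhk0 : coeff 0 (comp h k) = 0 := by rw [coeff_zero_comp k0, hc.1]
  -- Here k inverts the normalization p of f, so q ∘ h ∘ k goes from the first normal form through f
  -- and g to the second.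
  refine normalForm_injective hm (h := comp q (comp h k)) ?_ ?_
    (comp_eq_trans hhk0 hμ0 g0 hq.1 (comp_eq_trans k0 hμ0 f0 hc.1 hk H) (hq.comp_eq g0))
  · rw [coeff_zero_comp hhk0, hq.1]
  · rw [coeff_one_comp hhk0, coeff_one_comp k0]
    exact mul_ne_zero hq.coeff_one_ne_zero (mul_ne_zero hc.coeff_one_ne_zero k1)

/-- Formally conjugate locally analytic series are analytically conjugate, with the same
multiplier. -/
theorem exists_locallyAnalytic_conjugates {F : Type*} [NormedField F] [IsUltrametricDist F]
    [CharZero F] (hF : ∃ t : F, t ≠ 0 ∧ ‖t‖ < 1) {f g h : F⟦X⟧} (hf : LocallyAnalytic f)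
    (hg : LocallyAnalytic g) (hft : IsTangentToId f) (hgt : IsTangentToId g)
    (hc : Conjugates h f g) :
    ∃ k : F⟦X⟧, LocallyAnalytic k ∧ coeff 1 k = coeff 1 h ∧ Conjugates k f g := by
  have f0 := hft.1
  have g0 := hgt.1
  have h1 := hc.coeff_one_ne_zero
  have H := hc.comp_eq f0
  -- The identity is conjugate only to itself, by any invertible h, convergent or not; the dilation
  -- with the same multiplier replaces h.
  by_cases hgX : g = X
  · have hfX : f = X := by
      obtain ⟨h0, k, k0, -, hk, -⟩ := hc
      have := congrArg (comp k) H
      rw [hgX, X_comp h0, ← comp_assoc h0 f0, hk, X_comp f0] at this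
      exact this
    refine ⟨dilation (coeff 1 h), ?_, coeff_one_dilation _, conjugates_of_comp_eq
      (coeff_zero_dilation _) (by rwa [coeff_one_dilation]) f0 ?_⟩
    · refine locallyAnalytic_of_coeff_eq_zero (N := 1) fun n hn => ?_
      rw [dilation, coeff_C_mul, coeff_X, if_neg (by omega), mul_zero]
    · rw [hfX, hgX, comp_X, X_comp (coeff_zero_dilation _)]
  by_cases hfX : f = X
  · refine absurd ?_ hgX
    obtain ⟨h0, k, k0, hk, -, hg'⟩ := hc
    rw [← hg', hfX, X_comp k0, hk]
  obtain ⟨m, a, hfm⟩ := hft.exists_hasLeadingTerm hfX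
  obtain ⟨m', a', hgm⟩ := hgt.exists_hasLeadingTerm hgX
  obtain ⟨rfl, haa⟩ := hfm.eq_of_comp_eq hgm hc.1 h1 H
  set c := coeff 1 h with hcdef
  -- Away from the identity h itself converges: dividing it by c gives a conjugacy tangent to the
  -- identity from f to the rescaling of g by c, whose leading coefficient a' c^d equals a by `haa`.
  refine ⟨h, ?_, rfl, hc⟩
  obtain ⟨d, rfl⟩ : ∃ d, m = d + 1 := ⟨m - 1, by have := hfm.2.1; omega⟩
  have hlead : HasLeadingTerm (rescaling c g) (d + 1) a := by
    refine ⟨⟨coeff_zero_rescaling g0 _, ?_⟩, hfm.2.1, fun n hn hnm => ?_, ?_, hfm.2.2.2.2⟩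
    · rw [coeff_succ_rescaling g0 h1, zero_add, hgt.2]; simp
    · rw [coeff_rescaling g0, hgm.2.2.1 n hn hnm, mul_zero, mul_zero]
    · rw [coeff_succ_rescaling g0 h1, hgm.2.2.2.1]
      refine mul_right_cancel₀ h1 ?_
      rw [haa]; ring
  have hk0 : coeff 0 (comp (dilation c⁻¹) h) = 0 := by
    rw [coeff_zero_comp hc.1, coeff_zero_dilation]
  have hk : LocallyAnalytic (comp (dilation c⁻¹) h) := by
    refine locallyAnalytic_of_comp_eq hF hf (hg.rescaling g0 c) hfm hlead ⟨hk0, ?_⟩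
      (comp_eq_trans hc.1 f0 g0 (coeff_zero_dilation _) H (dilation_inv_comp g0 h1))
    rw [coeff_one_comp hc.1, coeff_one_dilation, ← hcdef, inv_mul_cancel₀ h1]
  have hfin := hk.C_mul c
  rwa [dilation_comp hc.1, ← mul_assoc, ← map_mul, mul_inv_cancel₀ h1, map_one, one_mul] at hfin

lemma locallyAnalytic_map {K L : Type*} [NormedField K] [NormedField L] [NormedAlgebra K L]
    {f : K⟦X⟧} (hf : LocallyAnalytic f) : LocallyAnalytic (PowerSeries.map (algebraMap K L) f) := by
  obtain ⟨R, hR, hfR⟩ := hf.exists_bound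
  refine locallyAnalytic_of_eventually_le (R := R) (by positivity) ?_
  filter_upwards [eventually_ge_atTop 1] with n hn
  rw [coeff_map, norm_algebraMap']
  exact hfR n hn

end Classification

end TangentToIdentity

/-! ### The three statements over K and its extensions. -/

theorem theorem1p1 (K : Type u) [NontriviallyNormedField K] [IsUltrametricDist K]
    [CompleteSpace K] [CharZero K] :
    -- Reduction to the normal form over `L = K(α)`, for each root `α` of `α ^ (m - 1) = a`.
    (∀ (f : K⟦X⟧) (m : ℕ) (a : K), TangentToIdentity.LocallyAnalytic f →
      TangentToIdentity.HasLeadingTerm f m a →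
      ∀ (L : Type v) [NormedField L] [NormedAlgebra K L] (α : L),
        α ^ (m - 1) = algebraMap K L a → K⟮α⟯ = ⊤ →
        ∃ (μ : L) (h : L⟦X⟧), TangentToIdentity.LocallyAnalytic h ∧
          TangentToIdentity.IsTangentToId h ∧
          TangentToIdentity.Conjugates
            (TangentToIdentity.comp h (TangentToIdentity.dilation α))
            (PowerSeries.map (algebraMap K L) f)
            (TangentToIdentity.normalForm m μ)) ∧
    -- `m` and `μ` are analytic invariants.
    (∀ (f g : K⟦X⟧) (m m' : ℕ) (a a' : K), TangentToIdentity.LocallyAnalytic f →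
      TangentToIdentity.LocallyAnalytic g →
      TangentToIdentity.HasLeadingTerm f m a → TangentToIdentity.HasLeadingTerm g m' a' →
      ∀ (L : Type v) [NormedField L] [NormedAlgebra K L],
        TangentToIdentity.AnalyticallyEquivalent
          (PowerSeries.map (algebraMap K L) f) (PowerSeries.map (algebraMap K L) g) →
        m = m' ∧
        ∀ μ μ' : L,
          TangentToIdentity.AnalyticallyEquivalent
            (PowerSeries.map (algebraMap K L) f) (TangentToIdentity.normalForm m μ) →
          TangentToIdentity.AnalyticallyEquivalent
            (PowerSeries.map (algebraMap K L) g) (TangentToIdentity.normalForm m' μ') →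
          μ = μ') ∧
    -- The formal and the analytic classifications coincide, for each multiplier `c` of the
    -- conjugating series (`c = 1` being conjugation by series tangent to the identity).
    (∀ f g : K⟦X⟧, TangentToIdentity.LocallyAnalytic f → TangentToIdentity.LocallyAnalytic g →
      TangentToIdentity.IsTangentToId f → TangentToIdentity.IsTangentToId g →
      ∀ c : K,
        (∃ h : K⟦X⟧, PowerSeries.coeff 1 h = c ∧ TangentToIdentity.Conjugates h f g) ↔
        (∃ h : K⟦X⟧, TangentToIdentity.LocallyAnalytic h ∧ PowerSeries.coeff 1 h = c ∧
          TangentToIdentity.Conjugates h f g)) := by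
  obtain ⟨t, ht0, ht1⟩ := NormedField.exists_norm_lt_one K
  have hK : ∃ t : K, t ≠ 0 ∧ ‖t‖ < 1 := ⟨t, norm_pos_iff.1 ht0, ht1⟩
  refine ⟨?_, ?_, ?_⟩
  · intro f m a hf hfm L _ _ α hα _
    have : CharZero L := charZero_of_injective_algebraMap (algebraMap K L).injective
    -- An absolute value is non-archimedean as soon as it is bounded by 1 on the natural numbers, a
    -- condition inherited from K.
    have : IsUltrametricDist L :=
      IsUltrametricDist.isUltrametricDist_of_forall_norm_natCast_le_one fun n => by
        rw [← map_natCast (algebraMap K L), norm_algebraMap']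
        exact IsUltrametricDist.norm_natCast_le_one K n
    have hL : ∃ t : L, t ≠ 0 ∧ ‖t‖ < 1 :=
      ⟨algebraMap K L t, by simpa using norm_pos_iff.1 ht0, by rwa [norm_algebraMap']⟩
    exact TangentToIdentity.exists_conjugates_normalForm hL
      (TangentToIdentity.locallyAnalytic_map hf) (hfm.map _) hα
  · intro f g m m' a a' _ _ hfm hgm L _ _ hfg
    have : CharZero L := charZero_of_injective_algebraMap (algebraMap K L).injective
    obtain ⟨hmm, hμ⟩ := TangentToIdentity.formal_invariants (hfm.map (algebraMap K L))
      (hgm.map (algebraMap K L)) (hfg.imp fun _ h => h.2)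
    exact ⟨hmm, fun μ μ' h h' => hμ μ μ' (h.imp fun _ h => h.2) (h'.imp fun _ h => h.2)⟩
  · intro f g hf hg hft hgt c
    constructor
    · rintro ⟨h, rfl, hc⟩
      exact TangentToIdentity.exists_locallyAnalytic_conjugates hK hf hg hft hgt hc
    · rintro ⟨h, -, h1, hc⟩
      exact ⟨h, h1, hc⟩
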